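/- Let $m\ge 1$ be an integer and $0<\alpha\le 1$. Consider the following random process of loopless multigraphs $G_t$ ($t=2,3,\dots$), where $G_t$ has vertices $v_1,\dots,v_t$. Write $e_t$ for the number of edges of $G_t$ and $d_w(t)$ for the degree of a vertex $w$ in $G_t$, both counted with multiplicity. The graph $G_2$ consists of $v_1,v_2$ and $2m$ parallel edges between them. For $t\ge 3$, given $G_{t-1}$: with probability $\alpha$, a new vertex $v_t$ is added together with $m$ edges from $v_t$ to vertices $w_1,\dots,w_m$ of $G_{t-1}$ that are chosen independently (repetitions are allowed and give parallel edges), with $\mathbb P(w_i=w)=d_w(t-1)/(2e_{t-1})$ for each vertex $w$ of $G_{t-1}$; with probability $1-\alpha$, a vertex $v$ of $G_{t-1}$ is chosen uniformly at random and $v_t$ is added as a copy of $v$, that is, $v_t$ is joined to each neighbour of $v$ with the same edge multiplicity as $v$ is (and to no other vertex). Let $D_k(t)$ be the number of vertices of degree $k$ in $G_t$. Assume that $2m(1-\alpha)<\alpha$. Then for every $k\ge 0$ the limit $$d_k=\lim_{t\to\infty}\frac{\mathbb E[D_k(t)]}{t}$$ exists, and $$d_k=0\ \ (0\le k<m),\qquad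 d_m=\frac{2\alpha}{m+2\alpha},\qquad d_k=d_m\prod_{i=m+1}^{k}\Bigl(1-\frac{1+2\alpha}{i+2\alpha}\Bigr)\ \ (k>m).$$ Consequently there is a constant $C>0$ such that $d_k\sim C\,k^{-(1+2\alpha)}$ as $k\to\infty$. -/

import Mathlib

open Filter Topology MeasureTheory Asymptotics
open scoped ENNReal NNReal

namespace HardCopying

/-- A loopless multigraph with at least one edge on the `n` vertices `v_1, …, v_n`
(represented by `Fin n`): `mult u v` is the number of parallel edges between `u` and `v`. -/
@[ext]
structure Multigraph (n : ℕ) where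
  mult : Fin n → Fin n → ℕ
  symm : ∀ u v, mult u v = mult v u
  loopless : ∀ u, mult u u = 0
  hasEdge : ∃ u v, mult u v ≠ 0

namespace Multigraph

variable {n : ℕ}

/-- The degree of a vertex, edges counted with multiplicity. -/
def degree (G : Multigraph n) (u : Fin n) : ℕ := ∑ v, G.mult u v

/-- The number of edges, counted with multiplicity. -/
def numEdges (G : Multigraph n) : ℕ := ∑ u, ∑ v, if u < v then G.mult u v else 0

/-- The number of vertices of degree `k`. -/
def degreeCount (G : Multigraph n) (k : ℕ) : ℕ :=
  (Finset.univ.filter fun u => G.degree u = k).card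

theorem sum_degree (G : Multigraph n) : ∑ u, G.degree u = 2 * G.numEdges := by
  have h : ∀ u v : Fin n, G.mult u v
      = (if u < v then G.mult u v else 0) + (if v < u then G.mult v u else 0) := by
    intro u v
    rcases lt_trichotomy u v with h | h | h
    · simp [h, h.not_gt]
    · subst h; simp [G.loopless]
    · simp [h, h.not_gt, G.symm u v]
  have h2 : ∑ u : Fin n, ∑ v, (if v < u then G.mult v u else 0) = G.numEdges := by
    rw [Finset.sum_comm]; rfl
  calc ∑ u, G.degree u
      = ∑ u : Fin n, ∑ v, ((if u < v then G.mult u v else 0)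
          + (if v < u then G.mult v u else 0)) :=
        Finset.sum_congr rfl fun u _ => Finset.sum_congr rfl fun v _ => h u v
    _ = G.numEdges + G.numEdges := by
        simp only [Finset.sum_add_distrib]; rw [h2]; rfl
    _ = 2 * G.numEdges := by ring

theorem numEdges_pos (G : Multigraph n) : 0 < G.numEdges := by
  obtain ⟨u, v, h⟩ := G.hasEdge
  have h1 : G.mult u v ≤ G.degree u :=
    Finset.single_le_sum (f := fun v => G.mult u v) (fun _ _ => Nat.zero_le _)
      (Finset.mem_univ v)
  have h2 : G.degree u ≤ ∑ u, G.degree u :=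
    Finset.single_le_sum (f := fun u => G.degree u) (fun _ _ => Nat.zero_le _)
      (Finset.mem_univ u)
  have h3 := G.sum_degree
  omega

/-- Two vertices joined by `2 * m` parallel edges. -/
def initial (m : ℕ) (hm : 1 ≤ m) : Multigraph 2 where
  mult u v := if u = v then 0 else 2 * m
  symm u v := by simp [eq_comm]
  loopless u := by simp
  hasEdge := ⟨0, 1, by simp; omega⟩

/-- Add a new (last) vertex, joined to each old vertex `u` by `f u` parallel edges. -/
def addVertex (G : Multigraph n) (f : Fin n → ℕ) : Multigraph (n + 1) where
  mult u v := Fin.lastCases (motive := fun _ => ℕ)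
    (Fin.lastCases (motive := fun _ => ℕ) 0 f v)
    (fun u' => Fin.lastCases (motive := fun _ => ℕ) (f u') (fun v' => G.mult u' v') v) u
  symm u v := by
    induction u using Fin.lastCases <;> induction v using Fin.lastCases <;> simp [G.symm]
  loopless u := by
    induction u using Fin.lastCases <;> simp [G.loopless]
  hasEdge := by
    obtain ⟨u, v, h⟩ := G.hasEdge
    exact ⟨u.castSucc, v.castSucc, by simpa using h⟩

/-- The new vertex is joined by one edge to each of `w 0, …, w (m - 1)`
(repetitions give parallel edges). -/
def attach {m : ℕ} (G : Multigraph n) (w : Fin m → Fin n) : Multigraph (n + 1) :=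
  G.addVertex fun u => (Finset.univ.filter fun i => w i = u).card

/-- The new vertex is a copy of `v`: it has the same neighbours as `v`, with the same
multiplicities. -/
def copy (G : Multigraph n) (v : Fin n) : Multigraph (n + 1) :=
  G.addVertex fun u => G.mult v u

/-- Preferential attachment: the vertex `w` has probability `d_w / (2 e)`. -/
noncomputable def prefAttach (G : Multigraph n) : PMF (Fin n) :=
  PMF.ofFintype (fun w => (G.degree w : ℝ≥0∞) / ((2 * G.numEdges : ℕ) : ℝ≥0∞)) (by
    have h := G.numEdges_pos
    simp only [div_eq_mul_inv]
    rw [← Finset.sum_mul, ← Nat.cast_sum, G.sum_degree]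
    exact ENNReal.mul_inv_cancel (by simp; omega) (ENNReal.natCast_ne_top _))

theorem nonempty_vertices (G : Multigraph n) : Nonempty (Fin n) := ⟨G.hasEdge.choose⟩

end Multigraph

/-- The law of `m` independent draws from `p`. -/
noncomputable def iid {β : Type*} [Fintype β] (p : PMF β) (m : ℕ) : PMF (Fin m → β) :=
  PMF.ofFintype (fun w => ∏ i, p (w i)) (by
    classical
    have h : ∑ x, p x = 1 := by rw [← tsum_fintype (L := .unconditional _)]; exact p.tsum_coe
    have h2 := Finset.prod_univ_sum (fun _ : Fin m => (Finset.univ : Finset β))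
      (fun _ x => p x)
    rw [Fintype.piFinset_univ] at h2
    rw [← h2]
    simp [h])

/-- A biased coin: `true` with probability `α`, `false` with probability `1 - α`. -/
noncomputable def coin (α : ℝ) (h0 : 0 ≤ α) (h1 : α ≤ 1) : PMF Bool :=
  PMF.ofFintype (fun b => if b then ENNReal.ofReal α else ENNReal.ofReal (1 - α)) (by
    simp only [Fintype.sum_bool, if_true, Bool.false_eq_true, if_false]
    rw [← ENNReal.ofReal_add h0 (by linarith)]
    simp)

/-- One step of the process. With probability `α` a new vertex is added, with `m` independent
preferential-attachment neighbours; with probability `1 - α` a uniformly chosen vertex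
is copied. -/
noncomputable def step (m : ℕ) (α : ℝ) (h0 : 0 ≤ α) (h1 : α ≤ 1) {n : ℕ} (G : Multigraph n) :
    PMF (Multigraph (n + 1)) :=
  haveI := G.nonempty_vertices
  (coin α h0 h1).bind fun b =>
    if b then (iid G.prefAttach m).map fun w => G.attach w
    else (PMF.uniformOfFintype (Fin n)).map fun v => G.copy v

/-- The law of the graph `G_{s+2}` (which has `s + 2` vertices): the process is the Markov
chain started at time `2` from `2 * m` parallel edges on two vertices. -/
noncomputable def graphLaw (m : ℕ) (hm : 1 ≤ m) (α : ℝ) (h0 : 0 ≤ α) (h1 : α ≤ 1) :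
    (s : ℕ) → PMF (Multigraph (s + 2))
  | 0 => PMF.pure (Multigraph.initial m hm)
  | s + 1 => (graphLaw m hm α h0 h1 s).bind fun G => step m α h0 h1 G

instance (n : ℕ) : MeasurableSpace (Multigraph n) := ⊤

/-- The expected number of vertices of degree `k` in `G_{s+2}`. -/
noncomputable def meanDegreeCount (m : ℕ) (hm : 1 ≤ m) (α : ℝ) (h0 : 0 ≤ α) (h1 : α ≤ 1)
    (k s : ℕ) : ℝ :=
  ∫ G, (G.degreeCount k : ℝ) ∂(graphLaw m hm α h0 h1 s).toMeasure

end HardCopying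

/-! Write t = s + 2 for the number of vertices, e for the number of edges, S for the sum of squared
degrees and P for the parallel-pair count. The hypothesis enters only through its consequence α >
2/3. A copied vertex raises the degree of u with mean deg(u)/t; an attached one with mean
m·deg(u)/(2e). If e ≈ ct, stationarity c = αm + 2(1 - α)c forces c(2α - 1) = αm, so the averaged
rate is deg(u)·((1 - α)/t + αm/(2ct)) = deg(u)/(2t). Adding the degree of the new vertex, E[D_{k+1}]
has drift (k D_k - (k+1) D_{k+1})/(2t) + (1 - α) D_{k+1}/t + α·1[m = k+1], and induction on k gives
the limit. Three errors must be negligible: collisions among the m attachments (at most S/t²),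
parallel edges in copying (at most P/t), and |e - ct|/t. Since e ≥ mt always, E[S] has relative
growth at most (4 - 3α)/t, and 4 - 3α < 2 exactly when α > 2/3; hence E[S] = o(t²). This feeds E[P]
= o(t) and E[(e - ct)²] = o(t²). `abs_drift_le` collects the errors and `tendsto_div_of_recursion`
solves the recursion; the tail comes from Euler's limit for Γ(2α). -/

namespace HardCopying

/-! ### Real recursions with drift of order 1/t -/

/-- A nonnegative sequence contracted by `1 - β / (s + 3)`, up to an error `o(1 / s)`, vanishes. -/
theorem tendsto_zero_of_contraction {z ε : ℕ → ℝ} {β : ℝ} (hβ : 0 < β) (hz : ∀ s, 0 ≤ z s)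
    (hε : Tendsto ε atTop (𝓝 0))
    (h : ∀ᶠ s : ℕ in atTop, z (s + 1) ≤ (1 - β / (s + 3)) * z s + ε s / (s + 3)) :
    Tendsto z atTop (𝓝 0) := by
  rw [Metric.tendsto_atTop]
  intro δ hδ
  have h1 : ∀ᶠ s : ℕ in atTop, ε s < β * (δ / 2) := hε.eventually_lt_const (by positivity)
  have h2 : ∀ᶠ s : ℕ in atTop, β ≤ (s : ℝ) + 3 :=
    (tendsto_natCast_atTop_atTop (R := ℝ)).eventually_ge_atTop (β - 3) |>.mono fun s hs => by linarith
  obtain ⟨N, hN⟩ := eventually_atTop.1 (h.and (h1.and h2))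
  -- The level δ/2 absorbs the error, which is eventually at most β·δ/2, so z - δ/2 contracts. The
  -- bound carries z N instead of z N - δ/2 because its sign is needed when 1 - x is replaced by
  -- exp(-x).
  have key : ∀ j : ℕ, z (N + j) - δ / 2
      ≤ Real.exp (-(β * ∑ i ∈ Finset.range j, 1 / (((N + i : ℕ) : ℝ) + 3))) * z N := by
    intro j
    induction j with
    | zero => simp; linarith
    | succ j ih =>
      obtain ⟨a1, a2, a3⟩ := hN (N + j) (by omega)
      have hp : (0 : ℝ) < ((N + j : ℕ) : ℝ) + 3 := by positivity
      set q : ℝ := ((N + j : ℕ) : ℝ) + 3 with hq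
      have b1 : 0 ≤ 1 - β / q := by rw [sub_nonneg, div_le_one hp]; exact a3
      have b2 : 1 - β / q ≤ Real.exp (-(β * (1 / q))) := by
        have := Real.add_one_le_exp (-(β * (1 / q)))
        have e : β * (1 / q) = β / q := by ring
        rw [e] at this ⊢; linarith
      have b3 : ε (N + j) / q ≤ β / q * (δ / 2) := by
        rw [div_mul_eq_mul_div]; gcongr
      have b4 : z (N + (j + 1)) - δ / 2 ≤ (1 - β / q) * (z (N + j) - δ / 2) := by
        have : N + (j + 1) = N + j + 1 := by ring
        rw [this]; linarith
      rw [Finset.sum_range_succ, mul_add, neg_add, Real.exp_add]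
      have hE := Real.exp_pos (-(β * ∑ i ∈ Finset.range j, 1 / (((N + i : ℕ) : ℝ) + 3)))
      have c1 := mul_le_mul_of_nonneg_left ih b1
      have c2 := mul_le_mul_of_nonneg_right b2 (mul_nonneg hE.le (hz N))
      rw [← hq]
      linarith
  -- Divergence of the harmonic series drives the product of contraction factors to 0.
  have hs : Tendsto (fun j : ℕ => ∑ i ∈ Finset.range j, 1 / (((N + i : ℕ) : ℝ) + 3)) atTop atTop := by
    rw [← not_summable_iff_tendsto_nat_atTop_of_nonneg (fun i => by positivity)]
    intro hs
    have : Summable (fun i : ℕ => 1 / ((i + (N + 3) : ℕ) : ℝ)) := by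
      refine hs.congr fun i => ?_
      push_cast; ring
    exact Real.not_summable_one_div_natCast
      ((summable_nat_add_iff (f := fun i : ℕ => 1 / (i : ℝ)) (N + 3)).1 this)
  have hlim : Tendsto (fun j : ℕ =>
      Real.exp (-(β * ∑ i ∈ Finset.range j, 1 / (((N + i : ℕ) : ℝ) + 3))) * z N) atTop (𝓝 0) := by
    have := (Real.tendsto_exp_neg_atTop_nhds_zero.comp (hs.const_mul_atTop hβ)).mul_const (z N)
    simpa using this
  obtain ⟨J, hJ⟩ := eventually_atTop.1 (hlim.eventually_lt_const (half_pos hδ))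
  refine ⟨N + J, fun n hn => ?_⟩
  obtain ⟨j, rfl⟩ : ∃ j, n = N + j := ⟨n - N, by omega⟩
  rw [Real.dist_eq, sub_zero, abs_of_nonneg (hz _)]
  have := hJ j (by omega)
  have := key j
  linarith

/-- A nonnegative sequence with relative growth `κ / t`, `κ < 1`, and source `o(1)` is `o(t)`. -/
theorem tendsto_div_zero_of_le {a g : ℕ → ℝ} {κ : ℝ} (hκ : κ < 1) (ha : ∀ s, 0 ≤ a s)
    (hg : Tendsto g atTop (𝓝 0))
    (h : ∀ s : ℕ, a (s + 1) ≤ (1 + κ / (s + 2)) * a s + g s) :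
    Tendsto (fun s : ℕ => a s / (s + 2)) atTop (𝓝 0) := by
  refine tendsto_zero_of_contraction (sub_pos.2 hκ) (fun s => div_nonneg (ha s) (by positivity)) hg
    (.of_forall fun s => ?_)
  have h2 : (0 : ℝ) < s + 2 := by positivity
  have h3 : (0 : ℝ) < s + 3 := by positivity
  have e : ((s + 1 : ℕ) : ℝ) + 2 = s + 3 := by push_cast; ring
  rw [e]
  calc a (s + 1) / (s + 3) ≤ ((1 + κ / (s + 2)) * a s + g s) / (s + 3) := by gcongr; exact h s
    _ = _ := by field_simp; ring

/-- The same with growth `κ / t`, `κ < 2`, at the quadratic scale. -/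
theorem tendsto_div_sq_zero_of_le {a g : ℕ → ℝ} {κ : ℝ} (h1 : 1 ≤ κ) (hκ : κ < 2) (ha : ∀ s, 0 ≤ a s)
    (hg : Tendsto (fun s : ℕ => g s / (s + 2)) atTop (𝓝 0)) (hg0 : ∀ s, 0 ≤ g s)
    (h : ∀ s : ℕ, a (s + 1) ≤ (1 + κ / (s + 2)) * a s + g s) :
    Tendsto (fun s : ℕ => a s / (s + 2) ^ 2) atTop (𝓝 0) := by
  -- Dividing by t lowers the exponent by one: (1 + κ/t)·t/(t+1) = 1 + (κ - 1)/(t+1). Replacing t+1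
  -- by t afterwards needs κ ≥ 1.
  have := tendsto_div_zero_of_le (a := fun s => a s / (s + 2)) (κ := κ - 1) (by linarith)
    (fun s => div_nonneg (ha s) (by positivity)) hg fun s => ?_
  · refine this.congr fun s => ?_
    rw [div_div, sq]
  · have h2 : (0 : ℝ) < s + 2 := by positivity
    have h3 : (0 : ℝ) < s + 3 := by positivity
    have e : ((s + 1 : ℕ) : ℝ) + 2 = s + 3 := by push_cast; ring
    rw [e]
    calc a (s + 1) / (s + 3) ≤ ((1 + κ / (s + 2)) * a s + g s) / (s + 3) := by gcongr; exact h s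
      _ = (1 + (κ - 1) / (s + 3)) * (a s / (s + 2)) + g s / (s + 3) := by field_simp; ring
      _ ≤ _ := by
        have := hg0 s
        have := ha s
        have : 0 ≤ κ - 1 := by linarith
        gcongr <;> linarith

/-- A linear recursion with relative drift `-b / t`, `b > -1`, and converging source. -/
theorem tendsto_div_of_recursion {a g : ℕ → ℝ} {b l : ℝ} (hb : -1 < b)
    (hg : Tendsto g atTop (𝓝 l))
    (h : ∀ s : ℕ, a (s + 1) = (1 - b / (s + 2)) * a s + g s) :
    Tendsto (fun s : ℕ => a s / (s + 2)) atTop (𝓝 (l / (1 + b))) := by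
  have hb' : 0 < 1 + b := by linarith
  rw [tendsto_iff_norm_sub_tendsto_zero]
  have hg' : Tendsto (fun s => ‖g s - l‖) atTop (𝓝 0) := tendsto_iff_norm_sub_tendsto_zero.1 hg
  refine tendsto_zero_of_contraction hb' (fun s => norm_nonneg _) hg' ?_
  have h2 : ∀ᶠ s : ℕ in atTop, b ≤ (s : ℝ) + 2 :=
    (tendsto_natCast_atTop_atTop (R := ℝ)).eventually_ge_atTop (b - 2) |>.mono fun s hs => by linarith
  filter_upwards [h2] with s hs
  have p2 : (0 : ℝ) < s + 2 := by positivity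
  have p3 : (0 : ℝ) < s + 3 := by positivity
  have e : ((s + 1 : ℕ) : ℝ) + 2 = s + 3 := by push_cast; ring
  -- The value l/(1 + b) is the fixed point of the normalized recursion, so the deviation from it
  -- contracts with β = 1 + b.
  have e2 : a (s + 1) / (s + 3) - l / (1 + b)
      = (1 - (1 + b) / (s + 3)) * (a s / (s + 2) - l / (1 + b)) + (g s - l) / (s + 3) := by
    rw [h]; field_simp; ring
  rw [e, e2]
  refine (norm_add_le _ _).trans ?_
  rw [norm_mul, norm_div, Real.norm_of_nonneg p3.le, Real.norm_of_nonneg (r := 1 - _)]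
  rw [sub_nonneg, div_le_one p3]; linarith

end HardCopying

/-! ### One-step changes of graph statistics -/

namespace HardCopying
namespace Multigraph

variable {n : ℕ}

@[simp]
theorem addVertex_degree_castSucc (G : Multigraph n) (f : Fin n → ℕ) (u : Fin n) :
    (G.addVertex f).degree u.castSucc = G.degree u + f u := by
  simp [degree, addVertex, Fin.sum_univ_castSucc]

@[simp]
theorem addVertex_degree_last (G : Multigraph n) (f : Fin n → ℕ) :
    (G.addVertex f).degree (Fin.last n) = ∑ u, f u := by
  simp [degree, addVertex, Fin.sum_univ_castSucc]

theorem addVertex_numEdges (G : Multigraph n) (f : Fin n → ℕ) :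
    (G.addVertex f).numEdges = G.numEdges + ∑ u, f u := by
  have h1 := (G.addVertex f).sum_degree
  have h2 := G.sum_degree
  simp only [Fin.sum_univ_castSucc, addVertex_degree_castSucc, addVertex_degree_last,
    Finset.sum_add_distrib] at h1
  omega

/-- The sum of the squares of the degrees. -/
def degreeSqSum (G : Multigraph n) : ℝ := ∑ u, (G.degree u : ℝ) ^ 2

/-- The number of ordered pairs of distinct parallel edges, each counted from both ends. -/
def parallelPairs (G : Multigraph n) : ℝ :=
  ∑ u, ∑ v, (G.mult u v : ℝ) * ((G.mult u v : ℝ) - 1)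

theorem natCast_mul_sub_one_nonneg (x : ℕ) : 0 ≤ (x : ℝ) * ((x : ℝ) - 1) := by
  rcases Nat.eq_zero_or_pos x with rfl | h
  · simp
  · have : (1 : ℝ) ≤ x := by exact_mod_cast h
    exact mul_nonneg (by positivity) (by linarith)

theorem degreeSqSum_nonneg (G : Multigraph n) : 0 ≤ G.degreeSqSum :=
  Finset.sum_nonneg fun _ _ => by positivity

theorem parallelPairs_nonneg (G : Multigraph n) : 0 ≤ G.parallelPairs :=
  Finset.sum_nonneg fun _ _ => Finset.sum_nonneg fun _ _ => natCast_mul_sub_one_nonneg _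

theorem degreeCount_eq_sum (G : Multigraph n) (k : ℕ) :
    (G.degreeCount k : ℝ) = ∑ u, if G.degree u = k then (1 : ℝ) else 0 := by
  simp [degreeCount]

theorem degreeCount_le (G : Multigraph n) (k : ℕ) : G.degreeCount k ≤ n :=
  (Finset.card_filter_le _ _).trans (by simp)

theorem sum_degree_real (G : Multigraph n) : ∑ u, (G.degree u : ℝ) = 2 * G.numEdges := by
  exact_mod_cast G.sum_degree

theorem addVertex_parallelPairs (G : Multigraph n) (f : Fin n → ℕ) :
    (G.addVertex f).parallelPairs
      = G.parallelPairs + 2 * ∑ u, (f u : ℝ) * ((f u : ℝ) - 1) := by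
  simp only [parallelPairs, addVertex, Fin.sum_univ_castSucc, Fin.lastCases_castSucc,
    Fin.lastCases_last, Finset.sum_add_distrib]
  simp
  ring

/-- The new vertex contributes (∑ f)² exactly, and the squares ∑ f² at old vertices are at most that
again, whence the factor 2. -/
theorem addVertex_degreeSqSum_le (G : Multigraph n) (f : Fin n → ℕ) :
    (G.addVertex f).degreeSqSum
      ≤ G.degreeSqSum + 2 * ∑ u, (f u : ℝ) * G.degree u + 2 * ((∑ u, f u : ℕ) : ℝ) ^ 2 := by
  have h : ∑ u, (f u : ℝ) ^ 2 ≤ ((∑ u, f u : ℕ) : ℝ) ^ 2 := by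
    push_cast
    exact Finset.sum_sq_le_sq_sum_of_nonneg fun _ _ => by positivity
  have e : (G.addVertex f).degreeSqSum
      = G.degreeSqSum + 2 * ∑ u, (f u : ℝ) * G.degree u + ∑ u, (f u : ℝ) ^ 2
        + ((∑ u, f u : ℕ) : ℝ) ^ 2 := by
    simp only [degreeSqSum, Fin.sum_univ_castSucc, addVertex_degree_castSucc,
      addVertex_degree_last, Finset.mul_sum, ← Finset.sum_add_distrib]
    congr 1
    refine Finset.sum_congr rfl fun u _ => ?_
    push_cast; ring
  linarith

/-- First-order expansion in the degree increment x: exact for x = 0 and x = 1, so only multiple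
hits cost anything, and x(x - 1) dominates that cost. -/
theorem abs_indicator_add_sub_le (d x k : ℕ) :
    |(if d + x = k + 1 then (1 : ℝ) else 0) - (if d = k + 1 then 1 else 0)
      - x * ((if d = k then 1 else 0) - if d = k + 1 then 1 else 0)| ≤ (x : ℝ) * ((x : ℝ) - 1) := by
  rcases x with _ | _ | x
  · simp
  · by_cases h1 : d = k
    · subst h1; simp
    · by_cases h2 : d = k + 1 <;> simp [h1, h2]
  · have hx : (0 : ℝ) ≤ x := by positivity
    push_cast
    by_cases h1 : d = k
    · subst h1
      rw [if_neg (by omega), if_neg (by omega), if_pos rfl, abs_le]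
      constructor <;> nlinarith
    · by_cases h2 : d = k + 1
      · rw [if_neg (by omega), if_pos h2, if_neg h1, abs_le]
        constructor <;> nlinarith
      · rw [if_neg h2, if_neg h1]
        split_ifs <;> rw [abs_le] <;> constructor <;> nlinarith

theorem abs_addVertex_degreeCount_sub_le (G : Multigraph n) (f : Fin n → ℕ) (k : ℕ) :
    |((G.addVertex f).degreeCount (k + 1) : ℝ) - G.degreeCount (k + 1)
      - (if ∑ u, f u = k + 1 then 1 else 0)
      - ∑ u, (f u : ℝ) * ((if G.degree u = k then 1 else 0) - if G.degree u = k + 1 then 1 else 0)|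
    ≤ ∑ u, (f u : ℝ) * ((f u : ℝ) - 1) := by
  have e : ((G.addVertex f).degreeCount (k + 1) : ℝ) - G.degreeCount (k + 1)
      - (if ∑ u, f u = k + 1 then 1 else 0)
      - ∑ u, (f u : ℝ) * ((if G.degree u = k then 1 else 0) - if G.degree u = k + 1 then 1 else 0)
      = ∑ u, ((if G.degree u + f u = k + 1 then (1 : ℝ) else 0)
        - (if G.degree u = k + 1 then 1 else 0)
        - f u * ((if G.degree u = k then 1 else 0) - if G.degree u = k + 1 then 1 else 0)) := by
    simp only [degreeCount_eq_sum, Fin.sum_univ_castSucc, addVertex_degree_castSucc,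
      addVertex_degree_last, Finset.sum_sub_distrib]
    ring
  rw [e]
  exact (Finset.abs_sum_le_sum_abs _ _).trans
    (Finset.sum_le_sum fun u _ => abs_indicator_add_sub_le _ _ _)

theorem sum_degree_mul_indicator (G : Multigraph n) (k : ℕ) :
    ∑ u, (G.degree u : ℝ) * ((if G.degree u = k then 1 else 0) - if G.degree u = k + 1 then 1 else 0)
      = k * G.degreeCount k - (k + 1) * G.degreeCount (k + 1) := by
  simp only [degreeCount_eq_sum, Finset.mul_sum, ← Finset.sum_sub_distrib]
  refine Finset.sum_congr rfl fun u _ => ?_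
  by_cases h1 : G.degree u = k
  · simp [h1]
  · by_cases h2 : G.degree u = k + 1 <;> simp [h1, h2]

/-! ### The copying step -/

/-- The mean of `F` over the copies of a uniform vertex. -/
noncomputable def copyMean (G : Multigraph n) (F : Multigraph (n + 1) → ℝ) : ℝ :=
  (∑ v, F (G.copy v)) / n

theorem copy_sum (G : Multigraph n) (v : Fin n) : ∑ u, G.mult v u = G.degree v := rfl

theorem sum_mult_mul (G : Multigraph n) (h : Fin n → ℝ) :
    ∑ v, ∑ u, (G.mult v u : ℝ) * h u = ∑ u, (G.degree u : ℝ) * h u := by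
  rw [Finset.sum_comm]
  refine Finset.sum_congr rfl fun u _ => ?_
  rw [← Finset.sum_mul, degree, Nat.cast_sum]
  congr 1
  exact Finset.sum_congr rfl fun v _ => by rw [G.symm]

theorem n_pos (G : Multigraph n) : (0 : ℝ) < n := by
  obtain ⟨u⟩ := G.nonempty_vertices
  exact_mod_cast u.pos

/-- Copying v duplicates row v of the multiplicity matrix, and its column by symmetry; averaging
over v gives 2/n of the total. -/
theorem copyMean_parallelPairs (G : Multigraph n) :
    G.copyMean parallelPairs = (1 + 2 / n) * G.parallelPairs := by
  have := G.n_pos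
  simp only [copyMean, copy, addVertex_parallelPairs, Finset.sum_add_distrib, ← Finset.mul_sum]
  rw [← parallelPairs]
  simp only [Finset.sum_const, Finset.card_univ, Fintype.card_fin, nsmul_eq_mul]
  field_simp

/-- Of the 4, two come from the cross term (u is hit deg(u)/n times on average) and two from the
squared degree of the copied vertex. -/
theorem copyMean_degreeSqSum_le (G : Multigraph n) :
    G.copyMean degreeSqSum ≤ (1 + 4 / n) * G.degreeSqSum := by
  have hn := G.n_pos
  rw [copyMean, div_le_iff₀ hn]
  refine (Finset.sum_le_sum fun v _ => G.addVertex_degreeSqSum_le _).trans (le_of_eq ?_)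
  simp only [Finset.sum_add_distrib, ← Finset.mul_sum, copy_sum, sum_mult_mul]
  have : ∑ u, (G.degree u : ℝ) * G.degree u = G.degreeSqSum := by simp [degreeSqSum, sq]
  rw [this]
  have : ∑ u, (G.degree u : ℝ) ^ 2 = G.degreeSqSum := rfl
  rw [this]
  simp only [Finset.sum_const, Finset.card_univ, Fintype.card_fin, nsmul_eq_mul]
  field_simp
  ring

/-- Exact expansion of the square, except that one nonpositive term is dropped; its sign is where c
≥ 0 is used. -/
theorem copyMean_numEdges_sq_le (G : Multigraph n) (c : ℝ) (hc : 0 ≤ c) :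
    G.copyMean (fun H => ((H.numEdges : ℝ) - c * (n + 1)) ^ 2)
      ≤ ((G.numEdges : ℝ) - c * n) ^ 2
        + 2 * ((G.numEdges : ℝ) - c * n) * (2 * G.numEdges / n - c)
        + G.degreeSqSum / n + c ^ 2 := by
  have hn := G.n_pos
  have e : G.copyMean (fun H => ((H.numEdges : ℝ) - c * (n + 1)) ^ 2)
      = ((G.numEdges : ℝ) - c * n) ^ 2
        + 2 * ((G.numEdges : ℝ) - c * n) * (2 * G.numEdges / n - c)
        + G.degreeSqSum / n + c ^ 2 - 2 * c * (2 * G.numEdges / n) := by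
    have : ∀ v, (((G.copy v).numEdges : ℝ) - c * (n + 1)) ^ 2
        = (((G.numEdges : ℝ) - c * n) - c) ^ 2
          + 2 * (((G.numEdges : ℝ) - c * n) - c) * G.degree v + (G.degree v : ℝ) ^ 2 := by
      intro v
      rw [copy, addVertex_numEdges, copy_sum]
      push_cast; ring
    simp only [copyMean, this, Finset.sum_add_distrib, ← Finset.mul_sum, sum_degree_real]
    rw [← degreeSqSum]
    simp only [Finset.sum_const, Finset.card_univ, Fintype.card_fin, nsmul_eq_mul]
    field_simp
    ring
  have : 0 ≤ 2 * c * (2 * G.numEdges / n) := by positivity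
  linarith

/-- The copy itself has degree k + 1 with probability D_{k+1}/n; the remaining drift comes from the
neighbours of the copied vertex, linearized at the cost of parallel edges. -/
theorem abs_copyMean_degreeCount_sub_le (G : Multigraph n) (k : ℕ) :
    |G.copyMean (fun H => (H.degreeCount (k + 1) : ℝ)) - G.degreeCount (k + 1)
      - G.degreeCount (k + 1) / n
      - (k * G.degreeCount k - (k + 1) * G.degreeCount (k + 1)) / n| ≤ G.parallelPairs / n := by
  have hn := G.n_pos
  have e : G.copyMean (fun H => (H.degreeCount (k + 1) : ℝ)) - G.degreeCount (k + 1)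
      - G.degreeCount (k + 1) / n
      - (k * G.degreeCount k - (k + 1) * G.degreeCount (k + 1)) / n
      = (∑ v, (((G.copy v).degreeCount (k + 1) : ℝ) - G.degreeCount (k + 1)
      - (if ∑ u, G.mult v u = k + 1 then 1 else 0)
      - ∑ u, (G.mult v u : ℝ)
        * ((if G.degree u = k then 1 else 0) - if G.degree u = k + 1 then 1 else 0))) / n := by
    simp only [Finset.sum_sub_distrib (f := fun _ => _ - _),
      Finset.sum_sub_distrib (f := fun _ => Nat.cast _)]
    have hlast : (∑ v, if ∑ u, G.mult v u = k + 1 then (1 : ℝ) else 0) = G.degreeCount (k + 1) :=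
      (G.degreeCount_eq_sum (k + 1)).symm
    rw [sum_mult_mul, sum_degree_mul_indicator, hlast, copyMean]
    simp only [Finset.sum_const, Finset.card_univ, Fintype.card_fin, nsmul_eq_mul]
    field_simp
  rw [e, abs_div, abs_of_pos hn]
  gcongr
  exact (Finset.abs_sum_le_sum_abs _ _).trans
    (Finset.sum_le_sum fun v _ => G.abs_addVertex_degreeCount_sub_le _ k)

/-! ### The preferential attachment step -/

/-- The probability that preferential attachment selects `u`. -/
noncomputable def prefWeight (G : Multigraph n) (u : Fin n) : ℝ := G.degree u / (2 * G.numEdges)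

/-- The mean of `F` over `m` independent preferential attachments. -/
noncomputable def attachMean (G : Multigraph n) (m : ℕ) (F : Multigraph (n + 1) → ℝ) : ℝ :=
  ∑ w : Fin m → Fin n, (∏ i, G.prefWeight (w i)) * F (G.attach w)

theorem numEdges_pos_real (G : Multigraph n) : (0 : ℝ) < G.numEdges := by
  exact_mod_cast G.numEdges_pos

theorem prefWeight_nonneg (G : Multigraph n) (u : Fin n) : 0 ≤ G.prefWeight u := by
  unfold prefWeight; positivity

theorem sum_prefWeight (G : Multigraph n) : ∑ u, G.prefWeight u = 1 := by
  have := G.numEdges_pos_real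
  simp only [prefWeight, ← Finset.sum_div, sum_degree_real]
  field_simp

theorem sum_prod_mul_prod {β : Type*} [Fintype β] {m : ℕ} (p : β → ℝ) (q : Fin m → β → ℝ) :
    ∑ w : Fin m → β, (∏ i, p (w i)) * ∏ i, q i (w i) = ∏ i, ∑ x, p x * q i x := by
  classical
  have h := Finset.prod_univ_sum (fun _ : Fin m => (Finset.univ : Finset β))
    (fun i x => p x * q i x)
  rw [Fintype.piFinset_univ] at h
  rw [h]
  simp only [Finset.prod_mul_distrib]

theorem sum_prod {β : Type*} [Fintype β] {m : ℕ} (p : β → ℝ) (hp : ∑ x, p x = 1) :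
    ∑ w : Fin m → β, (∏ i, p (w i)) = 1 := by
  simpa [hp] using sum_prod_mul_prod p (fun (_ : Fin m) _ => 1)

theorem sum_prod_mul_apply {β : Type*} [Fintype β] {m : ℕ} (p : β → ℝ) (hp : ∑ x, p x = 1)
    (g : β → ℝ) (i : Fin m) :
    ∑ w : Fin m → β, (∏ i, p (w i)) * g (w i) = ∑ x, p x * g x := by
  -- Independence: the test function is g in coordinate i and 1 elsewhere, so all other factors
  -- integrate to 1.
  have h := sum_prod_mul_prod p (fun (j : Fin m) => if j = i then g else fun _ => 1)
  rw [Fintype.prod_eq_single i (fun j hj => by simp [hj, hp])] at h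
  simp only [if_true] at h
  rw [← h]
  refine Finset.sum_congr rfl fun w _ => ?_
  congr 1
  exact ((Fintype.prod_eq_single i (fun j hj => by simp [hj])).trans (by simp)).symm

theorem sum_prod_mul_apply_mul_apply {β : Type*} [Fintype β] {m : ℕ} (p : β → ℝ)
    (hp : ∑ x, p x = 1) (g : β → ℝ) {i j : Fin m} (hij : i ≠ j) :
    ∑ w : Fin m → β, (∏ i, p (w i)) * (g (w i) * g (w j)) = (∑ x, p x * g x) ^ 2 := by
  have h := sum_prod_mul_prod p (fun (l : Fin m) => if l = i ∨ l = j then g else fun _ => 1)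
  rw [Fintype.prod_eq_mul i j hij (fun l hl => by simp [hl, hp])] at h
  simp only [true_or, or_true, if_true] at h
  rw [sq, ← h]
  refine Finset.sum_congr rfl fun w _ => ?_
  congr 1
  exact ((Fintype.prod_eq_mul i j hij (fun l hl => by simp [hl])).trans (by simp)).symm

theorem attach_sum {m : ℕ} (w : Fin m → Fin n) :
    ∑ u, (Finset.univ.filter fun i => w i = u).card = m := by
  simpa using (Finset.card_eq_sum_card_fiberwise (f := w) (s := Finset.univ)
    (t := Finset.univ) (by simp)).symm

theorem card_filter_mul_eq {m : ℕ} (w : Fin m → Fin n) (h : Fin n → ℝ) :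
    ∑ u, ((Finset.univ.filter fun i => w i = u).card : ℝ) * h u = ∑ i, h (w i) := by
  simp only [Finset.card_filter, Nat.cast_sum, Finset.sum_mul]
  rw [Finset.sum_comm]
  refine Finset.sum_congr rfl fun i _ => ?_
  simp

theorem card_filter_mul_sub_one {m : ℕ} (w : Fin m → Fin n) (u : Fin n) :
    ((Finset.univ.filter fun i => w i = u).card : ℝ)
      * (((Finset.univ.filter fun i => w i = u).card : ℝ) - 1)
    = ∑ i, ∑ j, if i = j then 0 else
        ((if w i = u then (1 : ℝ) else 0) * if w j = u then 1 else 0) := by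
  have : ∀ i j : Fin m, (if i = j then 0 else
        ((if w i = u then (1 : ℝ) else 0) * if w j = u then 1 else 0))
      = ((if w i = u then (1 : ℝ) else 0) * if w j = u then 1 else 0)
        - if i = j then (if w i = u then (1 : ℝ) else 0) else 0 := by
    intro i j
    by_cases h : i = j
    · subst h; by_cases h' : w i = u <;> simp [h']
    · simp [h]
  simp only [this, Finset.sum_sub_distrib, Finset.sum_ite_eq, Finset.mem_univ, if_true,
    ← Finset.mul_sum, ← Finset.sum_mul, Finset.card_filter, Nat.cast_sum, Nat.cast_ite,
    Nat.cast_one, Nat.cast_zero]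
  ring

/-- The mean number of hits, weighted by `h`. -/
theorem sum_prod_prefWeight_mul_hits (G : Multigraph n) (m : ℕ) (h : Fin n → ℝ) :
    ∑ w : Fin m → Fin n, (∏ i, G.prefWeight (w i))
      * ∑ u, ((Finset.univ.filter fun i => w i = u).card : ℝ) * h u
    = m / (2 * G.numEdges) * ∑ u, (G.degree u : ℝ) * h u := by
  simp only [card_filter_mul_eq, Finset.mul_sum]
  rw [Finset.sum_comm]
  rw [Finset.sum_congr rfl fun i _ => sum_prod_mul_apply _ G.sum_prefWeight h i]
  simp only [Finset.sum_const, Finset.card_univ, Fintype.card_fin, nsmul_eq_mul, Finset.mul_sum,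
    prefWeight]
  refine Finset.sum_congr rfl fun u _ => ?_
  ring

/-- Two distinct draws both hit u with probability `G.prefWeight u ^ 2`, and there are at most m²
ordered pairs of draws. -/
theorem sum_prod_prefWeight_mul_collisions_le (G : Multigraph n) (m : ℕ) :
    ∑ w : Fin m → Fin n, (∏ i, G.prefWeight (w i))
      * ∑ u, ((Finset.univ.filter fun i => w i = u).card : ℝ)
        * (((Finset.univ.filter fun i => w i = u).card : ℝ) - 1)
    ≤ m ^ 2 / (2 * G.numEdges) ^ 2 * G.degreeSqSum := by
  simp only [card_filter_mul_sub_one, Finset.mul_sum]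
  rw [Finset.sum_comm]
  have key : ∀ u, ∑ w : Fin m → Fin n, ∑ i, ∑ j, (∏ i, G.prefWeight (w i))
        * (if i = j then 0 else ((if w i = u then (1 : ℝ) else 0) * if w j = u then 1 else 0))
      ≤ m ^ 2 * G.prefWeight u ^ 2 := by
    intro u
    rw [Finset.sum_comm]
    have : ∀ i : Fin m, ∑ w : Fin m → Fin n, ∑ j, (∏ i, G.prefWeight (w i))
        * (if i = j then 0 else ((if w i = u then (1 : ℝ) else 0) * if w j = u then 1 else 0))
        ≤ ∑ j : Fin m, G.prefWeight u ^ 2 := by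
      intro i
      rw [Finset.sum_comm]
      refine Finset.sum_le_sum fun j _ => ?_
      by_cases hij : i = j
      · simp [hij]; positivity
      · simp only [hij, if_false]
        rw [sum_prod_mul_apply_mul_apply _ G.sum_prefWeight (fun x => if x = u then 1 else 0) hij]
        simp
    refine (Finset.sum_le_sum fun i _ => this i).trans (le_of_eq ?_)
    simp; ring
  refine (Finset.sum_le_sum fun u _ => key u).trans (le_of_eq ?_)
  simp only [degreeSqSum, Finset.mul_sum, prefWeight]
  refine Finset.sum_congr rfl fun u _ => ?_
  ring

theorem attachMean_mono (G : Multigraph n) (m : ℕ) {F : Multigraph (n + 1) → ℝ}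
    {H : (Fin m → Fin n) → ℝ} (h : ∀ w, F (G.attach w) ≤ H w) :
    G.attachMean m F ≤ ∑ w : Fin m → Fin n, (∏ i, G.prefWeight (w i)) * H w :=
  Finset.sum_le_sum fun w _ =>
    mul_le_mul_of_nonneg_left (h w) (Finset.prod_nonneg fun _ _ => G.prefWeight_nonneg _)

theorem attachMean_parallelPairs_le (G : Multigraph n) (m : ℕ) :
    G.attachMean m parallelPairs
      ≤ G.parallelPairs + 2 * (m ^ 2 / (2 * G.numEdges) ^ 2 * G.degreeSqSum) := by
  refine (G.attachMean_mono m fun w => (G.addVertex_parallelPairs _).le).trans ?_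
  simp only [mul_add, Finset.sum_add_distrib, ← Finset.sum_mul, sum_prod _ G.sum_prefWeight,
    one_mul, mul_left_comm _ (2 : ℝ), ← Finset.mul_sum (a := (2 : ℝ))]
  have := G.sum_prod_prefWeight_mul_collisions_le m
  linarith

theorem attachMean_degreeSqSum_le (G : Multigraph n) (m : ℕ) :
    G.attachMean m degreeSqSum
      ≤ (1 + m / G.numEdges) * G.degreeSqSum + 2 * (m : ℝ) ^ 2 := by
  refine (G.attachMean_mono m fun w => G.addVertex_degreeSqSum_le _).trans (le_of_eq ?_)
  simp only [attach_sum, mul_add, Finset.sum_add_distrib, ← Finset.sum_mul,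
    sum_prod _ G.sum_prefWeight, one_mul, mul_left_comm _ (2 : ℝ),
    ← Finset.mul_sum (a := (2 : ℝ)), sum_prod_prefWeight_mul_hits]
  have : ∑ u, (G.degree u : ℝ) * G.degree u = G.degreeSqSum := by simp [degreeSqSum, sq]
  rw [this]
  have := G.numEdges_pos_real
  field_simp

theorem attachMean_numEdges (G : Multigraph n) (m : ℕ) (φ : ℝ → ℝ) :
    G.attachMean m (fun H => φ H.numEdges) = φ (G.numEdges + m) := by
  simp only [attachMean, attach, addVertex_numEdges, attach_sum, ← Finset.sum_mul,
    sum_prod _ G.sum_prefWeight]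
  simp

theorem abs_attachMean_degreeCount_sub_le (G : Multigraph n) (m k : ℕ) :
    |G.attachMean m (fun H => (H.degreeCount (k + 1) : ℝ)) - G.degreeCount (k + 1)
      - (if m = k + 1 then 1 else 0)
      - m / (2 * G.numEdges) * (k * G.degreeCount k - (k + 1) * G.degreeCount (k + 1))|
    ≤ m ^ 2 / (2 * G.numEdges) ^ 2 * G.degreeSqSum := by
  refine le_trans ?_ (G.sum_prod_prefWeight_mul_collisions_le m)
  have e : G.attachMean m (fun H => (H.degreeCount (k + 1) : ℝ)) - G.degreeCount (k + 1)
      - (if m = k + 1 then 1 else 0)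
      - m / (2 * G.numEdges) * (k * G.degreeCount k - (k + 1) * G.degreeCount (k + 1))
      = ∑ w : Fin m → Fin n, (∏ i, G.prefWeight (w i))
        * (((G.attach w).degreeCount (k + 1) : ℝ) - G.degreeCount (k + 1)
      - (if ∑ u, (Finset.univ.filter fun i => w i = u).card = k + 1 then 1 else 0)
      - ∑ u, ((Finset.univ.filter fun i => w i = u).card : ℝ)
        * ((if G.degree u = k then 1 else 0) - if G.degree u = k + 1 then 1 else 0)) := by
    rw [← sum_degree_mul_indicator, ← sum_prod_prefWeight_mul_hits, attachMean]
    have key : ∀ (A X : (Fin m → Fin n) → ℝ) (b c : ℝ),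
        ∑ w, (∏ i, G.prefWeight (w i)) * (A w - b - c - X w)
          = ∑ w, (∏ i, G.prefWeight (w i)) * A w - b - c
            - ∑ w, (∏ i, G.prefWeight (w i)) * X w := by
      intro A X b c
      simp only [mul_sub, Finset.sum_sub_distrib, ← Finset.sum_mul,
        sum_prod _ G.sum_prefWeight, one_mul]
    simp only [attach_sum, key]
  rw [e]
  refine (Finset.abs_sum_le_sum_abs _ _).trans (Finset.sum_le_sum fun w _ => ?_)
  have hp : 0 ≤ ∏ i, G.prefWeight (w i) := Finset.prod_nonneg fun _ _ => G.prefWeight_nonneg _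
  rw [abs_mul, abs_of_nonneg hp]
  exact mul_le_mul_of_nonneg_left (G.abs_addVertex_degreeCount_sub_le _ k) hp

end Multigraph
end HardCopying

/-! ### Expectations under finitely supported laws -/

namespace HardCopying

/-- Multiplicities are unbounded, so the type of multigraphs is infinite; finite support of the law
is what makes every statistic integrable. -/
theorem _root_.PMF.integrable_of_finite_support {Ω : Type*} [MeasurableSpace Ω]
    [DiscreteMeasurableSpace Ω] (p : PMF Ω) (hp : p.support.Finite) (F : Ω → ℝ) :
    Integrable F p.toMeasure := by
  obtain ⟨C, hC⟩ := (hp.image fun x => ‖F x‖).bddAbove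
  refine Integrable.of_bound (Measurable.of_discrete (f := F)).aestronglyMeasurable C ?_
  rw [ae_iff, PMF.toMeasure_apply_eq_zero_iff _ (MeasurableSet.of_discrete)]
  rw [Set.disjoint_left]
  intro x hx hx'
  exact hx' (hC ⟨x, hx, rfl⟩)

theorem _root_.PMF.integral_eq_sum_of_support_subset {Ω : Type*} [MeasurableSpace Ω]
    [DiscreteMeasurableSpace Ω] (p : PMF Ω) {A : Finset Ω} (hA : p.support ⊆ A) (F : Ω → ℝ) :
    ∫ x, F x ∂p.toMeasure = ∑ x ∈ A, (p x).toReal * F x := by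
  rw [PMF.integral_eq_tsum _ _ (p.integrable_of_finite_support (A.finite_toSet.subset hA) F)]
  rw [tsum_eq_sum (s := A)]
  · simp
  · intro x hx
    have : p x = 0 := by
      by_contra h
      exact hx (hA ((p.mem_support_iff x).2 h))
    simp [this]

theorem _root_.PMF.finite_support_bind {Ω Ω' : Type*} (p : PMF Ω) (f : Ω → PMF Ω')
    (hp : p.support.Finite) (hf : ∀ a, (f a).support.Finite) : (p.bind f).support.Finite := by
  rw [PMF.support_bind]
  exact hp.biUnion fun a _ => hf a

theorem _root_.PMF.integral_bind {Ω Ω' : Type*} [MeasurableSpace Ω] [DiscreteMeasurableSpace Ω]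
    [MeasurableSpace Ω'] [DiscreteMeasurableSpace Ω'] (p : PMF Ω) (f : Ω → PMF Ω')
    (hp : p.support.Finite) (hf : ∀ a, (f a).support.Finite) (F : Ω' → ℝ) :
    ∫ x, F x ∂(p.bind f).toMeasure = ∫ a, ∫ x, F x ∂(f a).toMeasure ∂p.toMeasure := by
  classical
  have hb := p.finite_support_bind f hp hf
  have hA : p.support ⊆ hp.toFinset := by simp
  have hB : (p.bind f).support ⊆ hb.toFinset := by simp
  rw [PMF.integral_eq_sum_of_support_subset _ hB, PMF.integral_eq_sum_of_support_subset _ hA]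
  have h1 : ∀ x, ((p.bind f) x).toReal = ∑ a ∈ hp.toFinset, (p a).toReal * (f a x).toReal := by
    intro x
    rw [PMF.bind_apply, tsum_eq_sum (s := hp.toFinset), ENNReal.toReal_sum]
    · simp
    · intro a _
      exact ENNReal.mul_ne_top (p.apply_ne_top a) ((f a).apply_ne_top x)
    · intro a ha
      have : p a = 0 := by simpa using ha
      simp [this]
  simp only [h1, Finset.sum_mul]
  rw [Finset.sum_comm]
  refine Finset.sum_congr rfl fun a ha => ?_
  rw [PMF.integral_eq_sum_of_support_subset (A := hb.toFinset), Finset.mul_sum]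
  · simp only [mul_assoc]
  · intro x hx
    simp only [Set.Finite.coe_toFinset, PMF.support_bind, Set.mem_iUnion]
    exact ⟨a, by simpa using ha, hx⟩

theorem _root_.PMF.integral_map_fintype {ι Ω : Type*} [Fintype ι]
    [MeasurableSpace Ω] [DiscreteMeasurableSpace Ω] (p : PMF ι) (g : ι → Ω) (F : Ω → ℝ) :
    ∫ x, F x ∂(p.map g).toMeasure = ∑ i, (p i).toReal * F (g i) := by
  classical
  let _ : MeasurableSpace ι := ⊤
  rw [PMF.map, PMF.integral_bind _ _ (Set.toFinite _) (fun a => by simp [Function.comp])]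
  rw [PMF.integral_eq_sum_of_support_subset (A := Finset.univ) _ (by simp)]
  refine Finset.sum_congr rfl fun i _ => ?_
  rw [PMF.integral_eq_sum_of_support_subset (A := {g i}) _ (by simp [Function.comp])]
  simp [Function.comp]

instance (n : ℕ) : DiscreteMeasurableSpace (Multigraph n) := ⟨fun _ => trivial⟩

open Multigraph

theorem finite_support_step (m : ℕ) (α : ℝ) (h0 : 0 ≤ α) (h1 : α ≤ 1) {n : ℕ} (G : Multigraph n) :
    (step m α h0 h1 G).support.Finite := by
  have := G.nonempty_vertices
  refine PMF.finite_support_bind _ _ (Set.toFinite _) fun b => ?_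
  cases b
  · simp only [Bool.false_eq_true, if_false, PMF.support_map]; exact (Set.toFinite _).image _
  · simp only [if_true, PMF.support_map]; exact (Set.toFinite _).image _

theorem integral_step (m : ℕ) (α : ℝ) (h0 : 0 ≤ α) (h1 : α ≤ 1) {n : ℕ} (G : Multigraph n)
    (F : Multigraph (n + 1) → ℝ) :
    ∫ H, F H ∂(step m α h0 h1 G).toMeasure
      = α * G.attachMean m F + (1 - α) * G.copyMean F := by
  have := G.nonempty_vertices
  rw [step, PMF.integral_bind _ _ (Set.toFinite _)]
  · rw [PMF.integral_eq_sum_of_support_subset (A := Finset.univ) _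
      (fun b _ => Finset.mem_coe.2 (Finset.mem_univ b)), Fintype.sum_bool]
    simp only [Bool.false_eq_true, if_false, if_true, PMF.integral_map_fintype, coin, iid,
      prefAttach, PMF.ofFintype_apply, PMF.uniformOfFintype_apply, attachMean, copyMean,
      prefWeight, ENNReal.toReal_ofReal h0, ENNReal.toReal_ofReal (sub_nonneg.2 h1)]
    congr 2
    · refine Finset.sum_congr rfl fun w _ => ?_
      simp [ENNReal.toReal_prod]
    · simp only [Finset.sum_div]
      refine Finset.sum_congr rfl fun v _ => ?_
      simp; ring
  · intro b
    cases b
    · simp only [Bool.false_eq_true, if_false, PMF.support_map]; exact (Set.toFinite _).image _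
    · simp only [if_true, PMF.support_map]; exact (Set.toFinite _).image _

/-- The expectation of a function of the graph `G_{s+2}`. -/
noncomputable def graphMean (m : ℕ) (hm : 1 ≤ m) (α : ℝ) (h0 : 0 ≤ α) (h1 : α ≤ 1)
    (s : ℕ) (F : Multigraph (s + 2) → ℝ) : ℝ :=
  ∫ G, F G ∂(graphLaw m hm α h0 h1 s).toMeasure

section Mean

variable (m : ℕ) (hm : 1 ≤ m) (α : ℝ) (h0 : 0 ≤ α) (h1 : α ≤ 1)

theorem finite_support_graphLaw (s : ℕ) : (graphLaw m hm α h0 h1 s).support.Finite := by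
  induction s with
  | zero => simp [graphLaw]
  | succ s ih => exact PMF.finite_support_bind _ _ ih fun G => finite_support_step m α h0 h1 G

theorem graphMean_succ (s : ℕ) (F : Multigraph (s + 1 + 2) → ℝ) :
    graphMean m hm α h0 h1 (s + 1) F
      = graphMean m hm α h0 h1 s (fun G => α * G.attachMean m F + (1 - α) * G.copyMean F) := by
  simp only [graphMean, ← integral_step m α h0 h1]
  exact PMF.integral_bind _ _ (finite_support_graphLaw m hm α h0 h1 s)
    (fun G => finite_support_step m α h0 h1 G) F

theorem integrable_graphLaw (s : ℕ) (F : Multigraph (s + 2) → ℝ) :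
    Integrable F (graphLaw m hm α h0 h1 s).toMeasure :=
  PMF.integrable_of_finite_support _ (finite_support_graphLaw m hm α h0 h1 s) F

theorem graphMean_add (s : ℕ) (F H : Multigraph (s + 2) → ℝ) :
    graphMean m hm α h0 h1 s (fun G => F G + H G)
      = graphMean m hm α h0 h1 s F + graphMean m hm α h0 h1 s H :=
  integral_add (integrable_graphLaw ..) (integrable_graphLaw ..)

theorem graphMean_const_mul (s : ℕ) (c : ℝ) (F : Multigraph (s + 2) → ℝ) :
    graphMean m hm α h0 h1 s (fun G => c * F G) = c * graphMean m hm α h0 h1 s F :=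
  integral_const_mul _ _

theorem graphMean_const (s : ℕ) (c : ℝ) : graphMean m hm α h0 h1 s (fun _ => c) = c := by
  simp [graphMean]

/-- Comparison only on the support, because bounds such as e ≥ mt fail for arbitrary multigraphs. -/
theorem graphMean_mono (s : ℕ) {F H : Multigraph (s + 2) → ℝ}
    (h : ∀ G ∈ (graphLaw m hm α h0 h1 s).support, F G ≤ H G) :
    graphMean m hm α h0 h1 s F ≤ graphMean m hm α h0 h1 s H := by
  refine integral_mono_ae (integrable_graphLaw ..) (integrable_graphLaw ..) ?_
  rw [EventuallyLE, ae_iff, PMF.toMeasure_apply_eq_zero_iff _ (MeasurableSet.of_discrete),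
    Set.disjoint_left]
  exact fun x hx hx' => hx' (h x hx)

theorem graphMean_nonneg (s : ℕ) {F : Multigraph (s + 2) → ℝ} (h : ∀ G, 0 ≤ F G) :
    0 ≤ graphMean m hm α h0 h1 s F := integral_nonneg h

theorem abs_graphMean_le (s : ℕ) (F : Multigraph (s + 2) → ℝ) :
    |graphMean m hm α h0 h1 s F| ≤ graphMean m hm α h0 h1 s (fun G => |F G|) :=
  abs_integral_le_integral_abs

theorem support_induction {P : ∀ n, Multigraph n → Prop} (hi : P 2 (initial m hm))
    (ha : ∀ n (G : Multigraph n) (w : Fin m → Fin n), P n G → P (n + 1) (G.attach w))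
    (hc : ∀ n (G : Multigraph n) v, P n G → P (n + 1) (G.copy v)) (s : ℕ) :
    ∀ G ∈ (graphLaw m hm α h0 h1 s).support, P (s + 2) G := by
  induction s with
  | zero =>
    intro G hG
    simp only [graphLaw, PMF.support_pure, Set.mem_singleton_iff] at hG
    rw [hG]; exact hi
  | succ s ih =>
    intro G hG
    simp only [graphLaw, PMF.mem_support_bind_iff] at hG
    obtain ⟨H, hH, hG⟩ := hG
    have hP := ih H hH
    have := H.nonempty_vertices
    simp only [step, PMF.mem_support_bind_iff] at hG
    obtain ⟨b, -, hG⟩ := hG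
    cases b
    · simp only [Bool.false_eq_true, if_false, PMF.mem_support_map_iff] at hG
      obtain ⟨v, -, rfl⟩ := hG
      exact hc _ _ _ hP
    · simp only [if_true, PMF.mem_support_map_iff] at hG
      obtain ⟨v, -, rfl⟩ := hG
      exact ha _ _ _ hP

/-- The two claims are carried together: a copy adds deg(v) edges, and this is at least m only by
the degree bound. The initial 2m edges give equality at t = 2. -/
theorem degree_and_numEdges_bounds (s : ℕ) {G : Multigraph (s + 2)}
    (hG : G ∈ (graphLaw m hm α h0 h1 s).support) :
    (∀ u, m ≤ G.degree u) ∧ m * (s + 2) ≤ G.numEdges := by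
  refine support_induction m hm α h0 h1
    (P := fun n G => (∀ u, m ≤ G.degree u) ∧ m * n ≤ G.numEdges) ?_ ?_ ?_ s G hG
  · refine ⟨fun u => ?_, ?_⟩
    · fin_cases u <;> simp [degree, initial] <;> omega
    · have := (initial m hm).sum_degree
      simp only [degree, initial, Fin.sum_univ_two, Fin.isValue, zero_ne_one, one_ne_zero,
        if_true, if_false] at this
      simp only [initial]
      omega
  · rintro n G w ⟨h, h'⟩
    refine ⟨fun u => ?_, ?_⟩
    · induction u using Fin.lastCases with
      | last => rw [attach, addVertex_degree_last, attach_sum]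
      | cast u => rw [attach, addVertex_degree_castSucc]; exact (h u).trans (Nat.le_add_right _ _)
    · rw [attach, addVertex_numEdges, attach_sum]; linarith
  · rintro n G v ⟨h, h'⟩
    refine ⟨fun u => ?_, ?_⟩
    · induction u using Fin.lastCases with
      | last => rw [copy, addVertex_degree_last]; exact h v
      | cast u => rw [copy, addVertex_degree_castSucc]; exact (h u).trans (Nat.le_add_right _ _)
    · rw [copy, addVertex_numEdges, copy_sum]; linarith [h v]

theorem mul_le_numEdges_of_mem_support (s : ℕ) {G : Multigraph (s + 2)}
    (hG : G ∈ (graphLaw m hm α h0 h1 s).support) : (m : ℝ) * (s + 2) ≤ G.numEdges := by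
  exact_mod_cast (degree_and_numEdges_bounds m hm α h0 h1 s hG).2

end Mean
end HardCopying

/-! ### Moment bounds: degrees, parallel edges, edge concentration -/

namespace HardCopying

open Multigraph

section Mean

variable (m : ℕ) (hm : 1 ≤ m) (α : ℝ) (h0 : 0 ≤ α) (h1 : α ≤ 1)

theorem sq_div_numEdges_sq_le (s : ℕ) {G : Multigraph (s + 2)}
    (hG : G ∈ (graphLaw m hm α h0 h1 s).support) :
    (m : ℝ) ^ 2 / (2 * G.numEdges) ^ 2 ≤ 1 / (s + 2) ^ 2 := by
  have he := mul_le_numEdges_of_mem_support m hm α h0 h1 s hG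
  have := G.numEdges_pos_real
  rw [← div_pow, ← one_div_pow]
  gcongr ?_ ^ 2
  rw [div_le_div_iff₀ (by positivity) (by positivity)]
  linarith

/-- Attachment has relative growth m/e ≤ 1/t and copying 4/t; their mixture is α + 4(1 - α) = 4 -
3α, which must stay below 2. -/
theorem tendsto_graphMean_degreeSqSum (hα : 2 / 3 < α) :
    Tendsto (fun s : ℕ => graphMean m hm α h0 h1 s degreeSqSum / (s + 2) ^ 2) atTop (𝓝 0) := by
  refine tendsto_div_sq_zero_of_le (κ := 4 - 3 * α) (g := fun _ => 2 * (m : ℝ) ^ 2) (by linarith)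
    (by linarith) (fun s => graphMean_nonneg _ _ _ _ _ _ degreeSqSum_nonneg) ?_
    (fun _ => by positivity) fun s => ?_
  · exact tendsto_const_nhds.div_atTop
      (tendsto_atTop_add_const_right _ _ tendsto_natCast_atTop_atTop)
  · rw [graphMean_succ, ← graphMean_const_mul,
      ← graphMean_const m hm α h0 h1 s (2 * (m : ℝ) ^ 2), ← graphMean_add]
    refine graphMean_mono m hm α h0 h1 s fun G hG => ?_
    have a1 := G.attachMean_degreeSqSum_le m
    have a2 := G.copyMean_degreeSqSum_le
    have he := mul_le_numEdges_of_mem_support m hm α h0 h1 s hG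
    have hs : (0 : ℝ) < s + 2 := by positivity
    have a3 : (m : ℝ) / G.numEdges ≤ 1 / (s + 2) := by
      rw [div_le_div_iff₀ G.numEdges_pos_real hs]; linarith
    have a4 := mul_le_mul_of_nonneg_right a3 G.degreeSqSum_nonneg
    push_cast at a2
    have b1 : α * G.attachMean m degreeSqSum
        ≤ α * ((1 + 1 / (s + 2)) * G.degreeSqSum + 2 * (m : ℝ) ^ 2) :=
      mul_le_mul_of_nonneg_left (by linarith) h0
    have b2 := mul_le_mul_of_nonneg_left a2 (sub_nonneg.2 h1)
    have b3 : (1 - α) * (2 * (m : ℝ) ^ 2) ≥ 0 :=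
      mul_nonneg (sub_nonneg.2 h1) (by positivity)
    have e : (1 + (4 - 3 * α) / (s + 2)) * G.degreeSqSum + 2 * (m : ℝ) ^ 2
        = α * ((1 + 1 / (s + 2)) * G.degreeSqSum + 2 * (m : ℝ) ^ 2)
          + (1 - α) * ((1 + 4 / (s + 2)) * G.degreeSqSum) + (1 - α) * (2 * (m : ℝ) ^ 2) := by
      field_simp; ring
    linarith

/-- Copying gives relative growth 2(1 - α)/t, subcritical at the linear scale, and attachment
collisions add only E[S]/t² = o(1). -/
theorem tendsto_graphMean_parallelPairs (hα : 2 / 3 < α) :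
    Tendsto (fun s : ℕ => graphMean m hm α h0 h1 s parallelPairs / (s + 2)) atTop (𝓝 0) := by
  refine tendsto_div_zero_of_le (κ := 2 * (1 - α))
    (g := fun s => 2 * (graphMean m hm α h0 h1 s degreeSqSum / (s + 2) ^ 2)) (by linarith)
    (fun s => graphMean_nonneg _ _ _ _ _ _ parallelPairs_nonneg) ?_ fun s => ?_
  · simpa using (tendsto_graphMean_degreeSqSum m hm α h0 h1 hα).const_mul 2
  · have e : 2 * (graphMean m hm α h0 h1 s degreeSqSum / (s + 2) ^ 2)
        = graphMean m hm α h0 h1 s (fun G => 2 * (1 / (s + 2) ^ 2) * G.degreeSqSum) := by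
      rw [graphMean_const_mul]; ring
    rw [graphMean_succ, e, ← graphMean_const_mul, ← graphMean_add]
    refine graphMean_mono m hm α h0 h1 s fun G hG => ?_
    have a1 := G.attachMean_parallelPairs_le m
    have a3 := mul_le_mul_of_nonneg_right (sq_div_numEdges_sq_le m hm α h0 h1 s hG)
      G.degreeSqSum_nonneg
    rw [copyMean_parallelPairs]
    have b0 : 0 ≤ 2 * (1 / ((s : ℝ) + 2) ^ 2) * G.degreeSqSum := by
      have := G.degreeSqSum_nonneg
      positivity
    have b1 : α * G.attachMean m parallelPairs
        ≤ α * (G.parallelPairs + 2 * (1 / (s + 2) ^ 2) * G.degreeSqSum) :=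
      mul_le_mul_of_nonneg_left (by linarith) h0
    have b3 := mul_nonneg (sub_nonneg.2 h1) b0
    push_cast
    have e : (1 + 2 * (1 - α) / ((s : ℝ) + 2)) * G.parallelPairs
        = α * G.parallelPairs + (1 - α) * ((1 + 2 / (s + 2)) * G.parallelPairs) := by
      field_simp; ring
    linarith

theorem tendsto_graphMean_numEdges_sq (hα : 2 / 3 < α) {c : ℝ}
    (hc : c * (2 * α - 1) = α * m) :
    Tendsto (fun s : ℕ => graphMean m hm α h0 h1 s
      (fun G => ((G.numEdges : ℝ) - c * (s + 2)) ^ 2) / (s + 2) ^ 2) atTop (𝓝 0) := by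
  have hc0 : 0 ≤ c := by
    have : 0 ≤ c * (2 * α - 1) := by rw [hc]; positivity
    exact nonneg_of_mul_nonneg_left this (by linarith)
  refine tendsto_div_sq_zero_of_le (κ := 4 / 3)
    (g := fun s => graphMean m hm α h0 h1 s degreeSqSum / (s + 2) + (c ^ 2 + (m - c) ^ 2))
    (by norm_num) (by norm_num) (fun s => graphMean_nonneg _ _ _ _ _ _ fun _ => sq_nonneg _) ?_
    (fun s => ?_) fun s => ?_
  · have t1 := tendsto_graphMean_degreeSqSum m hm α h0 h1 hα
    have t2 : Tendsto (fun s : ℕ => (c ^ 2 + (m - c) ^ 2) / ((s : ℝ) + 2)) atTop (𝓝 0) :=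
      tendsto_const_nhds.div_atTop
        (tendsto_atTop_add_const_right _ _ tendsto_natCast_atTop_atTop)
    refine (by simpa using t1.add t2 : Tendsto _ _ (𝓝 (0 : ℝ))).congr fun s => ?_
    field_simp
  · have := graphMean_nonneg m hm α h0 h1 s degreeSqSum_nonneg
    positivity
  · have e : graphMean m hm α h0 h1 s degreeSqSum / (s + 2)
        = graphMean m hm α h0 h1 s (fun G => 1 / (s + 2) * G.degreeSqSum) := by
      rw [graphMean_const_mul]; ring
    rw [graphMean_succ, e, ← graphMean_const_mul, ← graphMean_const m hm α h0 h1 s (c ^ 2 + _),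
      ← graphMean_add, ← graphMean_add]
    refine graphMean_mono m hm α h0 h1 s fun G hG => ?_
    have e2 : ((s + 1 : ℕ) : ℝ) + 2 = ((s + 2 : ℕ) : ℝ) + 1 := by push_cast; ring
    simp only [e2]
    rw [G.attachMean_numEdges m (fun x => (x - c * (((s + 2 : ℕ) : ℝ) + 1)) ^ 2)]
    have a2 := mul_le_mul_of_nonneg_left (G.copyMean_numEdges_sq_le c hc0) (sub_nonneg.2 h1)
    refine (add_le_add_right a2 _).trans ?_
    push_cast
    have hs : (0 : ℝ) < s + 2 := by positivity
    set y : ℝ := (G.numEdges : ℝ) - c * (s + 2) with hy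
    have e3 : 2 * (G.numEdges : ℝ) / (s + 2) = 2 * c + 2 * y / (s + 2) := by
      rw [hy]; field_simp; ring
    have e4 : (G.numEdges : ℝ) + m - c * (s + 2 + 1) = y + (m - c) := by rw [hy]; ring
    rw [e3, e4]
    -- The equation for c is exactly what kills the term linear in y. The quadratic rate 4(1 - α) is
    -- below 4/3 since α > 2/3.
    have e5 : α * (y + (m - c)) ^ 2 + (1 - α) * (y ^ 2 + 2 * y * (2 * c + 2 * y / (s + 2) - c)
          + G.degreeSqSum / (s + 2) + c ^ 2)
        = (1 + 4 * (1 - α) / (s + 2)) * y ^ 2 + α * (m - c) ^ 2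
          + (1 - α) * (1 / (s + 2) * G.degreeSqSum + c ^ 2)
          + 2 * y * (α * m - c * (2 * α - 1)) := by
      field_simp; ring
    rw [e5, hc, sub_self, mul_zero, add_zero]
    have b1 : (1 + 4 * (1 - α) / (s + 2)) * y ^ 2 ≤ (1 + 4 / 3 / (s + 2)) * y ^ 2 := by
      gcongr; linarith
    have b2 : α * ((m : ℝ) - c) ^ 2 ≤ 1 * (m - c) ^ 2 := by gcongr
    have b3 : (1 - α) * (1 / (s + 2) * G.degreeSqSum + c ^ 2)
        ≤ 1 * (1 / (s + 2) * G.degreeSqSum + c ^ 2) := by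
      have := G.degreeSqSum_nonneg
      gcongr; linarith
    linarith

theorem graphMean_sq_le (s : ℕ) (F : Multigraph (s + 2) → ℝ) :
    graphMean m hm α h0 h1 s F ^ 2 ≤ graphMean m hm α h0 h1 s (fun G => F G ^ 2) := by
  set μ := graphMean m hm α h0 h1 s F with hμ
  -- Nonnegativity of the variance, expanded into a form to which linearity applies.
  have h : 0 ≤ graphMean m hm α h0 h1 s (fun G => F G ^ 2 + (-(2 * μ) * F G + μ ^ 2)) :=
    graphMean_nonneg m hm α h0 h1 s fun G => by nlinarith [sq_nonneg (F G - μ)]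
  rw [graphMean_add, graphMean_add, graphMean_const_mul, graphMean_const, ← hμ] at h
  nlinarith

theorem tendsto_graphMean_abs_numEdges (hα : 2 / 3 < α) {c : ℝ}
    (hc : c * (2 * α - 1) = α * m) :
    Tendsto (fun s : ℕ => graphMean m hm α h0 h1 s
      (fun G => |(G.numEdges : ℝ) - c * (s + 2)|) / (s + 2)) atTop (𝓝 0) := by
  have h := (tendsto_graphMean_numEdges_sq m hm α h0 h1 hα hc).sqrt
  rw [Real.sqrt_zero] at h
  refine squeeze_zero (fun s => div_nonneg
    (graphMean_nonneg m hm α h0 h1 s fun G => abs_nonneg _) (by positivity)) (fun s => ?_) h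
  refine Real.le_sqrt_of_sq_le ?_
  rw [div_pow]
  gcongr
  refine (graphMean_sq_le ..).trans (le_of_eq ?_)
  simp only [sq_abs]

/-! ### Drift and limits of the degree counts -/

/-- The one-step drift of the degree counts. -/
theorem abs_drift_le (hα : 2 / 3 < α) {c : ℝ} (hc : c * (2 * α - 1) = α * m) (k s : ℕ)
    {G : Multigraph (s + 2)} (hG : G ∈ (graphLaw m hm α h0 h1 s).support) :
    |α * G.attachMean m (fun H => (H.degreeCount (k + 1) : ℝ))
        + (1 - α) * G.copyMean (fun H => (H.degreeCount (k + 1) : ℝ))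
      + -(1 - ((k + 1) / 2 - (1 - α)) / (s + 2)) * G.degreeCount (k + 1)
      + (-(k / 2 / (s + 2)) * G.degreeCount k + -(α * if m = k + 1 then 1 else 0))|
    ≤ 1 / (s + 2) ^ 2 * G.degreeSqSum + (1 / (s + 2) * G.parallelPairs
      + (k + 1) / (s + 2) * |(G.numEdges : ℝ) - c * (s + 2)|) := by
  have a1 := G.abs_attachMean_degreeCount_sub_le m k
  have a2 := G.abs_copyMean_degreeCount_sub_le k
  have a3 := mul_le_mul_of_nonneg_right (sq_div_numEdges_sq_le m hm α h0 h1 s hG)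
    G.degreeSqSum_nonneg
  have he := mul_le_numEdges_of_mem_support m hm α h0 h1 s hG
  have hm' : (1 : ℝ) ≤ m := by exact_mod_cast hm
  have hs : (0 : ℝ) < s + 2 := by positivity
  have he' : (s : ℝ) + 2 ≤ G.numEdges := by nlinarith
  have hep := G.numEdges_pos_real
  have d1 : (G.degreeCount k : ℝ) ≤ s + 2 := by exact_mod_cast G.degreeCount_le k
  have d2 : (G.degreeCount (k + 1) : ℝ) ≤ s + 2 := by exact_mod_cast G.degreeCount_le (k + 1)
  have d3 : (0 : ℝ) ≤ G.degreeCount k := by positivity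
  have d4 : (0 : ℝ) ≤ G.degreeCount (k + 1) := by positivity
  push_cast at a2
  generalize G.attachMean m (fun H => (H.degreeCount (k + 1) : ℝ)) = A at *
  generalize G.copyMean (fun H => (H.degreeCount (k + 1) : ℝ)) = B at *
  generalize (G.degreeCount k : ℝ) = x at *
  generalize (G.degreeCount (k + 1) : ℝ) = y at *
  generalize (if m = k + 1 then (1 : ℝ) else 0) = i at *
  generalize (G.numEdges : ℝ) = e at *
  generalize ((s : ℝ) + 2) = t at *
  set L : ℝ := k * x - (k + 1) * y with hL
  have hk : (0 : ℝ) ≤ k := by positivity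
  have hLt : |L| ≤ (k + 1) * t := by
    rw [abs_le]
    constructor <;> nlinarith
  -- Attachment error, copying error, and the error of replacing αm/(2e) by (2α - 1)/(2t). With that
  -- replacement the coefficient of L is (1 - α)/t + (2α - 1)/(2t) = 1/(2t).
  have e1 : α * A + (1 - α) * B + -(1 - ((k + 1) / 2 - (1 - α)) / t) * y
      + (-(k / 2 / t) * x + -(α * i))
      = α * (A - y - i - m / (2 * e) * L) + (1 - α) * (B - y - y / t - L / t)
        + (α * m / (2 * e) - (2 * α - 1) / (2 * t)) * L := by
    rw [hL]; field_simp; ring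
  -- Substituting αm = c(2α - 1) exposes the factor e - ct; then |L|/t ≤ k + 1 and e ≥ t bound the
  -- rest.
  have e2 : (α * m / (2 * e) - (2 * α - 1) / (2 * t)) * L
      = -((2 * α - 1) / 2 * ((e - c * t) * (L / t) / e)) := by
    rw [← hc]; field_simp; ring
  have b3 : |(α * m / (2 * e) - (2 * α - 1) / (2 * t)) * L| ≤ (k + 1) / t * |e - c * t| := by
    rw [e2, abs_neg, abs_mul, abs_div _ e, abs_mul, abs_div L, abs_of_pos hs, abs_of_pos hep,
      abs_of_nonneg (show 0 ≤ (2 * α - 1) / 2 by linarith)]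
    have hLt' : |L| / t ≤ k + 1 := by rwa [div_le_iff₀ hs]
    calc (2 * α - 1) / 2 * (|e - c * t| * (|L| / t) / e)
        ≤ 1 * (|e - c * t| * (k + 1) / t) := by gcongr; linarith
      _ = _ := by ring
  rw [e1]
  have b1 : |α * (A - y - i - m / (2 * e) * L)| ≤ 1 / t ^ 2 * G.degreeSqSum := by
    rw [abs_mul, abs_of_nonneg h0]
    calc _ ≤ 1 * (1 / t ^ 2 * G.degreeSqSum) := by gcongr; exact a1.trans a3
      _ = _ := one_mul _
  have b2 : |(1 - α) * (B - y - y / t - L / t)| ≤ 1 / t * G.parallelPairs := by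
    rw [abs_mul, abs_of_nonneg (sub_nonneg.2 h1)]
    calc _ ≤ 1 * (1 / t * G.parallelPairs) := by
          gcongr
          · linarith
          · exact a2.trans (by rw [one_div_mul_eq_div])
      _ = _ := one_mul _
  exact (abs_add_three _ _ _).trans (by linarith)

/-- The limiting degree density, by its recursion. -/
noncomputable def limitDensity (m : ℕ) (α : ℝ) : ℕ → ℝ
  | 0 => 0
  | k + 1 => (k / 2 * limitDensity m α k + α * if m = k + 1 then 1 else 0)
      / (1 + ((k + 1) / 2 - (1 - α)))

theorem meanDegreeCount_zero (s : ℕ) : meanDegreeCount m hm α h0 h1 0 s = 0 := by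
  have h : graphMean m hm α h0 h1 s (fun G => (G.degreeCount 0 : ℝ))
      ≤ graphMean m hm α h0 h1 s (fun _ => 0) := by
    refine graphMean_mono m hm α h0 h1 s fun G hG => ?_
    have hd := (degree_and_numEdges_bounds m hm α h0 h1 s hG).1
    have : G.degreeCount 0 = 0 := by
      rw [degreeCount, Finset.card_eq_zero, Finset.filter_eq_empty_iff]
      intro u _ hu
      have := hd u
      omega
    simp [this]
  rw [graphMean_const] at h
  exact le_antisymm h (graphMean_nonneg m hm α h0 h1 s fun _ => by positivity)

theorem tendsto_meanDegreeCount_div (hα : 2 / 3 < α) (k : ℕ) :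
    Tendsto (fun s : ℕ => meanDegreeCount m hm α h0 h1 k s / (s + 2)) atTop
      (𝓝 (limitDensity m α k)) := by
  induction k with
  | zero => simp [meanDegreeCount_zero, limitDensity]
  | succ k ih =>
    rw [limitDensity]
    have hk : (0 : ℝ) ≤ k := by positivity
    set b : ℝ := (k + 1) / 2 - (1 - α) with hb
    -- The source g is defined as the exact residual, so the recursion is an identity and all
    -- content lies in the convergence of g.
    refine tendsto_div_of_recursion (b := b)
      (g := fun s => meanDegreeCount m hm α h0 h1 (k + 1) (s + 1)
        - (1 - b / (s + 2)) * meanDegreeCount m hm α h0 h1 (k + 1) s)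
      (by rw [hb]; linarith) ?_ (fun s => by ring)
    obtain ⟨c, hc⟩ : ∃ c : ℝ, c * (2 * α - 1) = α * m :=
      ⟨α * m / (2 * α - 1), div_mul_cancel₀ _ (by linarith)⟩
    have herr : Tendsto (fun s : ℕ => meanDegreeCount m hm α h0 h1 (k + 1) (s + 1)
        - (1 - b / (s + 2)) * meanDegreeCount m hm α h0 h1 (k + 1) s
        - (k / 2 * (meanDegreeCount m hm α h0 h1 k s / (s + 2))
          + α * if m = k + 1 then 1 else 0)) atTop (𝓝 0) := by
      have hB := (tendsto_graphMean_degreeSqSum m hm α h0 h1 hα).add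
        ((tendsto_graphMean_parallelPairs m hm α h0 h1 hα).add
          ((tendsto_graphMean_abs_numEdges m hm α h0 h1 hα hc).const_mul ((k : ℝ) + 1)))
      rw [mul_zero, add_zero, add_zero] at hB
      refine squeeze_zero_norm (fun s => ?_) hB
      have hmean := graphMean_mono m hm α h0 h1 s
        fun G hG => abs_drift_le m hm α h0 h1 hα hc k s hG
      have := (abs_graphMean_le ..).trans hmean
      simp only [graphMean_add, graphMean_const_mul, graphMean_const] at this
      rw [Real.norm_eq_abs]
      refine (le_of_eq ?_).trans (this.trans (le_of_eq ?_))
      · have e : meanDegreeCount m hm α h0 h1 (k + 1) (s + 1) =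
            α * graphMean m hm α h0 h1 s
              (fun G => G.attachMean m fun H => (H.degreeCount (k + 1) : ℝ))
            + (1 - α) * graphMean m hm α h0 h1 s
              (fun G => G.copyMean fun H => (H.degreeCount (k + 1) : ℝ)) := by
          rw [← graphMean_const_mul, ← graphMean_const_mul, ← graphMean_add]
          exact graphMean_succ m hm α h0 h1 s _
        rw [e]
        simp only [meanDegreeCount, graphMean]
        congr 1
        ring
      · ring
    simpa using herr.add ((ih.const_mul ((k : ℝ) / 2)).add_const (α * if m = k + 1 then 1 else 0))

end Mean

/-! ### Closed form and power-law tail of the limit -/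

theorem limitDensity_of_lt (m : ℕ) (α : ℝ) {k : ℕ} (hk : k < m) : limitDensity m α k = 0 := by
  induction k with
  | zero => rfl
  | succ k ih => rw [limitDensity, ih (by omega), if_neg (by omega)]; simp

theorem limitDensity_self {m : ℕ} (hm : 1 ≤ m) {α : ℝ} :
    limitDensity m α m = 2 * α / (m + 2 * α) := by
  obtain ⟨k, rfl⟩ : ∃ k, m = k + 1 := ⟨m - 1, by omega⟩
  rw [limitDensity, limitDensity_of_lt _ _ (Nat.lt_succ_self k), if_pos rfl, mul_zero, zero_add,
    mul_one, ← mul_div_mul_left α _ two_ne_zero]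
  push_cast
  congr 1; ring

theorem limitDensity_succ {m k : ℕ} (hk : m ≤ k) {α : ℝ} (h0 : 0 < α) :
    limitDensity m α (k + 1) = k / (k + 1 + 2 * α) * limitDensity m α k := by
  rw [limitDensity, if_neg (by omega), mul_zero, add_zero]
  have h : (1 : ℝ) + ((k + 1) / 2 - (1 - α)) = (k + 1 + 2 * α) / 2 := by ring
  have : (0 : ℝ) < k + 1 + 2 * α := by positivity
  rw [h]
  field_simp

theorem limitDensity_eq_prod {m k : ℕ} (hk : m ≤ k) {α : ℝ} (h0 : 0 < α) :
    limitDensity m α k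
      = (∏ i ∈ Finset.Icc (m + 1) k, (1 - (1 + 2 * α) / ((i : ℝ) + 2 * α)))
        * limitDensity m α m := by
  induction k, hk using Nat.le_induction with
  | base => simp
  | succ k hk ih =>
    rw [limitDensity_succ hk h0, ih, Finset.prod_Icc_succ_top (by omega)]
    have : (0 : ℝ) < k + 1 + 2 * α := by positivity
    push_cast
    rw [one_sub_div this.ne']
    ring

/-- The ratio k/(k + 1 + 2α) is that of k!/∏_{j ≤ k}(2α + j) up to the factor (k + 1)/k, so k·d_k is
a constant multiple of this quotient, which is `Real.GammaSeq (2 * α) k` divided by k^(2α). -/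
theorem limitDensity_eq_GammaSeq {m : ℕ} (hm : 1 ≤ m) {α : ℝ} (h0 : 0 < α) :
    ∃ K : ℝ, 0 < K ∧ ∀ k, m ≤ k →
      limitDensity m α k = K * Real.GammaSeq (2 * α) k * (k : ℝ) ^ (-(1 + 2 * α)) := by
  have hr : ∀ k : ℕ, 0 < ((k.factorial : ℕ) : ℝ) / ∏ j ∈ Finset.range (k + 1), (2 * α + j) := by
    intro k
    have : 0 < ∏ j ∈ Finset.range (k + 1), (2 * α + (j : ℝ)) :=
      Finset.prod_pos fun _ _ => by positivity
    positivity
  have hm0 : (0 : ℝ) < m := by exact_mod_cast hm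
  have key : ∀ k, m ≤ k → limitDensity m α k * k
      = limitDensity m α m * m / (m.factorial / ∏ j ∈ Finset.range (m + 1), (2 * α + j))
        * (k.factorial / ∏ j ∈ Finset.range (k + 1), (2 * α + j)) := by
    intro k hk
    induction k, hk using Nat.le_induction with
    | base => rw [div_mul_cancel₀ _ (hr m).ne']
    | succ k hk ih =>
      have h1 : (0 : ℝ) < k + 1 + 2 * α := by positivity
      have h2 : ((k + 1).factorial : ℝ) / ∏ j ∈ Finset.range (k + 1 + 1), (2 * α + (j : ℝ))
          = (k.factorial / ∏ j ∈ Finset.range (k + 1), (2 * α + (j : ℝ)))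
            * ((k + 1) / (k + 1 + 2 * α)) := by
        rw [Finset.prod_range_succ _ (k + 1), Nat.factorial_succ]
        push_cast
        rw [div_mul_div_comm]
        congr 1 <;> ring
      rw [h2, ← mul_assoc, ← ih, limitDensity_succ hk h0]
      push_cast
      ring
  refine ⟨limitDensity m α m * m / (m.factorial / ∏ j ∈ Finset.range (m + 1), (2 * α + j)),
    ?_, fun k hk => ?_⟩
  · refine div_pos (mul_pos ?_ hm0) (hr m)
    rw [limitDensity_self hm]
    positivity
  · have hk0 : (0 : ℝ) < k := hm0.trans_le (by exact_mod_cast hk)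
    have hkey := key k hk
    rw [← eq_div_iff hk0.ne'] at hkey
    rw [hkey, Real.GammaSeq, neg_add, Real.rpow_add hk0, Real.rpow_neg_one,
      Real.rpow_neg hk0.le]
    have := Real.rpow_pos_of_pos hk0 (2 * α)
    field_simp

theorem limitDensity_isEquivalent {m : ℕ} (hm : 1 ≤ m) {α : ℝ} (h0 : 0 < α) :
    ∃ C : ℝ, 0 < C ∧
      limitDensity m α ~[atTop] (fun k : ℕ => C * (k : ℝ) ^ (-(1 + 2 * α))) := by
  obtain ⟨K, hK, h⟩ := limitDensity_eq_GammaSeq hm h0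
  have hG : 0 < Real.Gamma (2 * α) := Real.Gamma_pos_of_pos (by positivity)
  refine ⟨K * Real.Gamma (2 * α), by positivity, ?_⟩
  have h1 : (fun k => K * Real.GammaSeq (2 * α) k)
      ~[atTop] (fun _ => K * Real.Gamma (2 * α)) :=
    (isEquivalent_const_iff_tendsto (by positivity)).2
      ((Real.GammaSeq_tendsto_Gamma _).const_mul K)
  refine (h1.mul (IsEquivalent.refl (u := fun k : ℕ => (k : ℝ) ^ (-(1 + 2 * α))))).congr_left ?_
  filter_upwards [eventually_ge_atTop m] with k hk
  exact (h k hk).symm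

end HardCopying

theorem theorem1 (m : ℕ) (hm : 1 ≤ m) (α : ℝ) (h0 : 0 < α) (h1 : α ≤ 1)
    (hα : 2 * (m : ℝ) * (1 - α) < α) :
    ∃ d : ℕ → ℝ,
      (∀ k : ℕ, Tendsto
        (fun s : ℕ => HardCopying.meanDegreeCount m hm α h0.le h1 k s / ((s + 2 : ℕ) : ℝ))
        atTop (𝓝 (d k))) ∧
      (∀ k : ℕ, k < m → d k = 0) ∧
      d m = 2 * α / ((m : ℝ) + 2 * α) ∧
      (∀ k : ℕ, m < k →
        d k = (∏ i ∈ Finset.Icc (m + 1) k, (1 - (1 + 2 * α) / ((i : ℝ) + 2 * α))) * d m) ∧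
      ∃ C : ℝ, 0 < C ∧
        d ~[atTop] (fun k : ℕ => C * (k : ℝ) ^ (-(1 + 2 * α))) := by
  have hm' : (1 : ℝ) ≤ m := by exact_mod_cast hm
  -- As m ≥ 1, the hypothesis gives 2(1 - α) < α.
  have hα' : 2 / 3 < α := by nlinarith
  refine ⟨HardCopying.limitDensity m α, fun k => ?_,
    fun k hk => HardCopying.limitDensity_of_lt m α hk, HardCopying.limitDensity_self hm,
    fun k hk => HardCopying.limitDensity_eq_prod hk.le h0,
    HardCopying.limitDensity_isEquivalent hm h0⟩
  simpa using HardCopying.tendsto_meanDegreeCount_div m hm α h0.le h1 hα' k
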